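/- Let $D$ be the set of functions $x:[0,1]\to\mathbb{R}$ that are right-continuous and have left limits, and let $\Lambda$ be the set of strictly increasing continuous functions from $[0,1]$ onto $[0,1]$. Let $e$ be the identity function on $[0,1]$, and for $\lambda\in\Lambda$ put $$\|\lambda-e\|=\sup_{s\in[0,1]}|\lambda(s)-s|,\qquad \|\lambda\|^0=\sup_{0\le s<s'\le 1}\Big|\log\frac{\lambda(s')-\lambda(s)}{s'-s}\Big|\in[0,\infty].$$ Equip $D$ with the Skorohod $J_1$-metric $$d_{J_1}^0(x,y)=\inf_{\lambda\in\Lambda}\Big\{\|\lambda\|^0\vee\sup_{s\in[0,1]}|x(s)-y(\lambda(s))|\Big\}.$$ Let $D([0,1];D)$ be the set of functions $x:[0,1]\to D$ that are right-continuous and have left limits (in $D$) with respect to $d_{J_1}^0$, and for $x,y:[0,1]\to D$ put $\rho_D(x,y)=\sup_{t\in[0,1]}d_{J_1}^0(x(t),y(t))$. For $x,y\in D([0,1];D)$ let $$d_D(x,y)=\inf_{\lambda\in\Lambda}\{\|\lambda-e\|\vee\rho_D(x,y\circ\lambda)\},\qquad d_D^0(x,y)=\inf_{\lambda\in\Lambda}\{\|\lambda\|^0\vee\rho_D(x,y\circ\lambda)\}.$$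 Theorem. The functions $d_D$ and $d_D^0$ are (finite-valued) metrics on $D([0,1];D)$ and they are equivalent, that is, they induce the same topology. The space $D([0,1];D)$ is separable under $d_D$ and under $d_D^0$, and it is complete under $d_D^0$. -/

import Mathlib

open Filter
open scoped ENNReal Topology unitInterval

/-- A function `x : [0,1] → S` that is right-continuous and has left limits with respect to the
distance `edist` of `S`. (At `t = 1` the first condition and at `t = 0` the second one is
trivial, since then `t` is the only point of `[t, 1]`, and `[0, t)` is empty.) -/
@[ext]
structure Cadlag (S : Type*) [EDist S] where
  /-- the underlying function -/
  toFun : I → S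
  right_continuous : ∀ t : I, Tendsto (fun s => edist (toFun s) (toFun t)) (𝓝[≥] t) (𝓝 0)
  left_limits : ∀ t : I, ∃ l : S, Tendsto (fun s => edist (toFun s) l) (𝓝[<] t) (𝓝 0)

namespace Cadlag

instance {S : Type*} [EDist S] : CoeFun (Cadlag S) (fun _ => I → S) := ⟨Cadlag.toFun⟩

/-- The set `Λ` of strictly increasing continuous functions from `[0,1]` onto `[0,1]`. -/
def timeChanges : Set (I → I) :=
  {l | StrictMono l ∧ Continuous l ∧ Function.Surjective l}

/-- `‖l - e‖ = sup_t |l t - t|`, where `e` is the identity. -/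
noncomputable def supDev (l : I → I) : ℝ≥0∞ :=
  ⨆ t : I, ENNReal.ofReal |(l t : ℝ) - (t : ℝ)|

/-- `‖l‖⁰ = sup_{s < s'} |log ((l s' - l s) / (s' - s))|`, possibly infinite. -/
noncomputable def logDev (l : I → I) : ℝ≥0∞ :=
  ⨆ (s : I) (s' : I) (_ : s < s'),
    ENNReal.ofReal |Real.log (((l s' : ℝ) - (l s : ℝ)) / ((s' : ℝ) - (s : ℝ)))|

/-- The uniform distance `ρ(x, y) = sup_t edist (x t) (y t)` of functions `[0,1] → S`. -/
noncomputable def unifDist {S : Type*} [EDist S] (x y : I → S) : ℝ≥0∞ :=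
  ⨆ t : I, edist (x t) (y t)

/-- The Skorokhod distance `d(x, y) = inf_{l ∈ Λ} ‖l - e‖ ∨ ρ(x, y ∘ l)`. -/
noncomputable def skorokhodDist {S : Type*} [EDist S] (x y : Cadlag S) : ℝ≥0∞ :=
  ⨅ l ∈ timeChanges, supDev l ⊔ unifDist x (y ∘ l)

/-- The modified Skorokhod distance `d⁰(x, y) = inf_{l ∈ Λ} ‖l‖⁰ ∨ ρ(x, y ∘ l)`. -/
noncomputable def skorokhodDist0 {S : Type*} [EDist S] (x y : Cadlag S) : ℝ≥0∞ :=
  ⨅ l ∈ timeChanges, logDev l ⊔ unifDist x (y ∘ l)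

/-- `Cadlag S` is given the distance `d⁰` whenever it serves as a space of values. -/
noncomputable instance {S : Type*} [EDist S] : EDist (Cadlag S) := ⟨skorokhodDist0⟩

end Cadlag

/-- The Skorokhod space `D` of real càdlàg functions on `[0,1]`; as an `EDist` type it carries
the distance `d⁰_{J₁}`. -/
abbrev SkorokhodD : Type := Cadlag ℝ

/-- The space `D([0,1]; D)` of functions `[0,1] → D` that are right-continuous with left limits
with respect to `d⁰_{J₁}`, that is, for the `J₁` topology of `D`. -/
abbrev SkorokhodDD : Type := Cadlag SkorokhodD

namespace Cadlag

/-! Everything is proved for `Cadlag S` over an arbitrary extended metric space `S`. With the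
distance d⁰ on `Cadlag S`, finiteness, separability and completeness pass from `S` to `Cadlag S`.
Applying this twice, from ℝ to D and from D to D([0,1]; D), gives the theorem.

The main tool is `exists_subdivision`: a càdlàg function oscillates by at most ε on each cell of
some finite subdivision. This makes its range bounded, so the distances are finite. It also gives
the nontrivial half of the equivalence: a time change that is uniformly close to the identity may be
replaced by its piecewise linear interpolation at the subdivision points. The interpolation has
slopes near 1, and the replacement costs only the oscillation (`exists_timeChangeDist_logDev_lt`).

For separability, the subdivision points are moved to a regular grid, where step functions with
values in a dense sequence suffice (`exists_step_near`). For completeness, time changes linking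
successive terms of a fast Cauchy sequence are composed infinitely often. Bounds on slopes survive
the limit, so the limit is again a time change (`exists_limit_iterComp`), and the reparametrized
sequence converges uniformly. -/

theorem orderIso_mem_timeChanges (e : I ≃o I) : ⇑e ∈ timeChanges :=
  ⟨e.strictMono, e.continuous, e.surjective⟩

theorem exists_orderIso_of_mem_timeChanges {l : I → I} (hl : l ∈ timeChanges) :
    ∃ e : I ≃o I, ⇑e = l :=
  ⟨hl.1.orderIsoOfSurjective l hl.2.2, rfl⟩

/-- The infimum of `N e ∨ ρ(x, y ∘ e)` over the time changes `e`. -/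
noncomputable def timeChangeDist (N : (I → I) → ℝ≥0∞) {S : Type*} [EDist S] (x y : Cadlag S) :
    ℝ≥0∞ :=
  ⨅ e : I ≃o I, N e ⊔ unifDist x (y ∘ e)

/-- Order isomorphisms carry inverses and composition, which the metric axioms need. -/
theorem iInf_timeChanges_eq (N : (I → I) → ℝ≥0∞) {S : Type*} [EDist S] (x y : Cadlag S) :
    ⨅ l ∈ timeChanges, N l ⊔ unifDist x (y ∘ l) = timeChangeDist N x y := by
  apply le_antisymm
  · exact le_iInf fun e => iInf₂_le _ (orderIso_mem_timeChanges e)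
  · refine le_iInf₂ fun l hl => ?_
    obtain ⟨e, rfl⟩ := exists_orderIso_of_mem_timeChanges hl
    exact iInf_le _ e

theorem skorokhodDist_eq {S : Type*} [EDist S] (x y : Cadlag S) :
    skorokhodDist x y = timeChangeDist supDev x y :=
  iInf_timeChanges_eq _ _ _

theorem skorokhodDist0_eq {S : Type*} [EDist S] (x y : Cadlag S) :
    skorokhodDist0 x y = timeChangeDist logDev x y :=
  iInf_timeChanges_eq _ _ _

theorem timeChangeDist_lt_iff {N : (I → I) → ℝ≥0∞} {S : Type*} [EDist S] {x y : Cadlag S}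
    {r : ℝ≥0∞} :
    timeChangeDist N x y < r ↔ ∃ e : I ≃o I, N e < r ∧ unifDist x (y ∘ e) < r := by
  simp only [timeChangeDist, iInf_lt_iff, sup_lt_iff]

theorem timeChangeDist_le {N : (I → I) → ℝ≥0∞} {S : Type*} [EDist S] {x y : Cadlag S}
    {r : ℝ≥0∞} (e : I ≃o I) (h : N e ≤ r) (h' : unifDist x (y ∘ e) ≤ r) :
    timeChangeDist N x y ≤ r :=
  (iInf_le _ e).trans (sup_le h h')

/-! ### The two lengths of a time change -/

section Deviation

theorem supDev_refl : supDev (OrderIso.refl I) = 0 := by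
  simp [supDev]

theorem supDev_symm (e : I ≃o I) : supDev e.symm = supDev e := by
  have h : ∀ f : I ≃o I, supDev f ≤ supDev f.symm := fun f => by
    refine iSup_le fun t => ?_
    refine le_trans ?_ (le_iSup _ (f t))
    simp [abs_sub_comm]
  exact le_antisymm (h e.symm) (h e)

theorem supDev_trans (e f : I ≃o I) : supDev (e.trans f) ≤ supDev e + supDev f := by
  refine iSup_le fun t => ?_
  have h1 : ENNReal.ofReal |(e t : ℝ) - t| ≤ supDev e :=
    le_iSup (fun t : I => ENNReal.ofReal |(e t : ℝ) - t|) t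
  have h2 : ENNReal.ofReal |(f (e t) : ℝ) - e t| ≤ supDev f :=
    le_iSup (fun t : I => ENNReal.ofReal |(f t : ℝ) - t|) (e t)
  refine le_trans ?_ (add_le_add h1 h2)
  rw [← ENNReal.ofReal_add (abs_nonneg _) (abs_nonneg _)]
  apply ENNReal.ofReal_le_ofReal
  rw [add_comm]
  exact abs_sub_le _ _ _

theorem abs_sub_le_of_supDev_le {l : I → I} {c : ℝ} (hc : 0 ≤ c)
    (h : supDev l ≤ ENNReal.ofReal c) (t : I) : |(l t : ℝ) - t| ≤ c :=
  (ENNReal.ofReal_le_ofReal_iff hc).1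
    ((le_iSup (fun t : I => ENNReal.ofReal |(l t : ℝ) - t|) t).trans h)

theorem le_logDev (l : I → I) {s t : I} (h : s < t) :
    ENNReal.ofReal |Real.log (((l t : ℝ) - l s) / ((t : ℝ) - s))| ≤ logDev l :=
  le_iSup_of_le s (le_iSup_of_le t (le_iSup_of_le h le_rfl))

theorem logDev_le {l : I → I} {r : ℝ≥0∞}
    (h : ∀ s t : I, s < t →
      ENNReal.ofReal |Real.log (((l t : ℝ) - l s) / ((t : ℝ) - s))| ≤ r) : logDev l ≤ r :=
  iSup_le fun s => iSup_le fun t => iSup_le (h s t)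

theorem logDev_refl : logDev (OrderIso.refl I) = 0 := by
  refine le_antisymm (logDev_le fun s t h => ?_) zero_le
  have : (0 : ℝ) < (t : ℝ) - s := sub_pos.2 h
  simp [div_self this.ne']

theorem logDev_symm (e : I ≃o I) : logDev e.symm = logDev e := by
  have h : ∀ f : I ≃o I, logDev f ≤ logDev f.symm := fun f => by
    refine logDev_le fun s t hst => ?_
    refine le_trans (le_of_eq ?_) (le_logDev f.symm (f.strictMono hst))
    rw [f.symm_apply_apply, f.symm_apply_apply, ← inv_div, Real.log_inv, abs_neg]
  exact le_antisymm (h e.symm) (h e)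

theorem logDev_trans (e f : I ≃o I) : logDev (e.trans f) ≤ logDev e + logDev f := by
  refine logDev_le fun s t hst => ?_
  have het := e.strictMono hst
  have h0 : (0 : ℝ) < (t : ℝ) - s := sub_pos.2 hst
  have h1 : (0 : ℝ) < (e t : ℝ) - e s := sub_pos.2 het
  have h2 : (0 : ℝ) < (f (e t) : ℝ) - f (e s) := sub_pos.2 (f.strictMono het)
  refine le_trans ?_ (add_le_add (le_logDev e hst) (le_logDev f het))
  rw [← ENNReal.ofReal_add (abs_nonneg _) (abs_nonneg _)]
  apply ENNReal.ofReal_le_ofReal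
  refine le_trans (le_of_eq ?_) (abs_add_le _ _)
  rw [← Real.log_mul (by positivity) (by positivity), mul_comm, div_mul_div_cancel₀ h1.ne']
  rfl

/-- For increasing `l`, the bound `‖l‖⁰ ≤ c` says that all slopes lie in `[exp (-c), exp c]`. -/
theorem logDev_le_iff {l : I → I} (hl : StrictMono l) {c : ℝ} (hc : 0 ≤ c) :
    logDev l ≤ ENNReal.ofReal c ↔ ∀ s t : I, s < t →
      Real.exp (-c) * ((t : ℝ) - s) ≤ (l t : ℝ) - l s ∧
        (l t : ℝ) - l s ≤ Real.exp c * ((t : ℝ) - s) := by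
  have key : ∀ s t : I, s < t →
      (ENNReal.ofReal |Real.log (((l t : ℝ) - l s) / ((t : ℝ) - s))| ≤ ENNReal.ofReal c ↔
      Real.exp (-c) * ((t : ℝ) - s) ≤ (l t : ℝ) - l s ∧
        (l t : ℝ) - l s ≤ Real.exp c * ((t : ℝ) - s)) := fun s t hst => by
    have h0 : (0 : ℝ) < (t : ℝ) - s := sub_pos.2 hst
    have h1 : (0 : ℝ) < (l t : ℝ) - l s := sub_pos.2 (hl hst)
    rw [ENNReal.ofReal_le_ofReal_iff hc, abs_le, Real.le_log_iff_exp_le (div_pos h1 h0),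
      Real.log_le_iff_le_exp (div_pos h1 h0), le_div_iff₀ h0, div_le_iff₀ h0]
  exact ⟨fun h s t hst => (key s t hst).1 ((le_logDev l hst).trans h),
    fun h => logDev_le fun s t hst => (key s t hst).2 (h s t hst)⟩

/-- Since `e` fixes `0`, the slope bounds on `[0, t]` put `e t` between `exp (-c) * t` and `exp c *
t`, and both factors are within `2 * c` of `1`. -/
theorem supDev_le_of_logDev_le (e : I ≃o I) {c : ℝ} (hc : 0 ≤ c) (hc1 : c ≤ 1)
    (h : logDev e ≤ ENNReal.ofReal c) : supDev e ≤ ENNReal.ofReal (2 * c) := by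
  refine iSup_le fun t => ENNReal.ofReal_le_ofReal ?_
  have hexp : |Real.exp c - 1| ≤ 2 * |c| := Real.abs_exp_sub_one_le (by rwa [abs_of_nonneg hc])
  have hexp' : |Real.exp (-c) - 1| ≤ 2 * |-c| :=
    Real.abs_exp_sub_one_le (by rwa [abs_neg, abs_of_nonneg hc])
  rw [abs_neg] at hexp'
  rw [abs_of_nonneg hc, abs_le] at hexp hexp'
  have h0 : e 0 = 0 := e.map_bot
  rcases eq_or_lt_of_le (unitInterval.nonneg' (t := t)) with rfl | ht
  · simp [h0, hc]
  · obtain ⟨h1, h2⟩ := (logDev_le_iff e.strictMono hc).1 h 0 t ht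
    rw [h0] at h1 h2
    simp only [Set.Icc.coe_zero, sub_zero] at h1 h2
    have ht0 : (0 : ℝ) ≤ t := t.2.1
    have ht1 : (t : ℝ) ≤ 1 := t.2.2
    rw [abs_le]
    constructor <;> nlinarith

end Deviation

/-! ### Symmetry and triangle inequality -/

section Metric

variable {S : Type*} [EMetricSpace S]

theorem edist_le_unifDist (x y : I → S) (t : I) : edist (x t) (y t) ≤ unifDist x y :=
  le_iSup (fun t => edist (x t) (y t)) t

theorem unifDist_self (x : I → S) : unifDist x x = 0 := by
  simp [unifDist]

theorem unifDist_comm (x y : I → S) : unifDist x y = unifDist y x := by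
  simp [unifDist, edist_comm]

theorem unifDist_triangle (x y z : I → S) : unifDist x z ≤ unifDist x y + unifDist y z :=
  iSup_le fun t => (edist_triangle _ (y t) _).trans
    (add_le_add (edist_le_unifDist x y t) (edist_le_unifDist y z t))

theorem unifDist_comp_equiv (x y : I → S) (e : I ≃ I) :
    unifDist (x ∘ e) (y ∘ e) = unifDist x y :=
  e.iSup_comp (g := fun t => edist (x t) (y t))

/-- A length on time changes that controls the deviation from the identity. -/
structure IsLength (N : (I → I) → ℝ≥0∞) : Prop where
  refl : N (OrderIso.refl I) = 0
  symm : ∀ e : I ≃o I, N e.symm = N e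
  trans : ∀ e f : I ≃o I, N (e.trans f) ≤ N e + N f
  supDev_lt : ∀ r : ℝ, 0 < r →
    ∃ δ : ℝ≥0∞, 0 < δ ∧ ∀ e : I ≃o I, N e < δ → supDev e ≤ ENNReal.ofReal r

theorem isLength_supDev : IsLength supDev where
  refl := supDev_refl
  symm := supDev_symm
  trans := supDev_trans
  supDev_lt r hr := ⟨ENNReal.ofReal r, by simpa using hr, fun _ h => h.le⟩

theorem isLength_logDev : IsLength logDev where
  refl := logDev_refl
  symm := logDev_symm
  trans := logDev_trans
  supDev_lt r hr := by
    refine ⟨ENNReal.ofReal (min (r / 2) 1), by simpa using hr, fun e h => ?_⟩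
    refine (supDev_le_of_logDev_le e (by positivity) (min_le_right _ _) h.le).trans
      (ENNReal.ofReal_le_ofReal ?_)
    linarith [min_le_left (r / 2) 1]

variable {N : (I → I) → ℝ≥0∞} (hN : IsLength N)
include hN

theorem timeChangeDist_self (x : Cadlag S) : timeChangeDist N x x = 0 :=
  le_antisymm (timeChangeDist_le (OrderIso.refl I) hN.refl.le (unifDist_self _).le) zero_le

theorem timeChangeDist_comm (x y : Cadlag S) : timeChangeDist N x y = timeChangeDist N y x := by
  have h : ∀ x y : Cadlag S, timeChangeDist N x y ≤ timeChangeDist N y x := fun x y => by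
    refine le_iInf fun e => timeChangeDist_le e.symm (le_sup_of_le_left (hN.symm e).le)
      (le_sup_of_le_right (le_of_eq ?_))
    rw [unifDist_comm, ← unifDist_comp_equiv _ _ e.toEquiv]
    congr 1
    ext t
    simp
  exact le_antisymm (h x y) (h y x)

theorem timeChangeDist_triangle (x y z : Cadlag S) :
    timeChangeDist N x z ≤ timeChangeDist N x y + timeChangeDist N y z := by
  refine ENNReal.le_of_forall_pos_le_add fun ε hε hfin => ?_
  have hε2 : (ε : ℝ≥0∞) / 2 ≠ 0 := by simpa using hε.ne'
  obtain ⟨e, he, he'⟩ := timeChangeDist_lt_iff.1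
    (ENNReal.lt_add_right (ENNReal.add_lt_top.1 hfin).1.ne hε2)
  obtain ⟨f, hf, hf'⟩ := timeChangeDist_lt_iff.1
    (ENNReal.lt_add_right (ENNReal.add_lt_top.1 hfin).2.ne hε2)
  have hsum : timeChangeDist N x y + ε / 2 + (timeChangeDist N y z + ε / 2) =
      timeChangeDist N x y + timeChangeDist N y z + ε := by
    rw [add_add_add_comm, ENNReal.add_halves]
  rw [← hsum]
  refine timeChangeDist_le (e.trans f) ((hN.trans e f).trans (add_le_add he.le hf.le)) ?_
  refine (unifDist_triangle _ (y ∘ e) _).trans (add_le_add he'.le ?_)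
  refine le_trans (le_of_eq ?_) hf'.le
  exact unifDist_comp_equiv (y : I → S) (z ∘ f) e.toEquiv

end Metric

/-! ### Separation of points -/

section Tendsto

variable {S : Type*} [EMetricSpace S]

variable {N : (I → I) → ℝ≥0∞} (hN : IsLength N)
include hN

/-- A time change may carry `t` to the left of a jump of `y`, so the comparison is made at a point
`s` slightly to the right of `t`, and right continuity leads back to `t`. The endpoint `1` has no
such `s`, but every time change fixes it. -/
theorem eq_of_timeChangeDist_eq_zero {x y : Cadlag S} (h : timeChangeDist N x y = 0) :
    x = y := by
  have happ : ∀ r : ℝ, 0 < r → ∀ ε : ℝ≥0∞, 0 < ε → ∃ e : I ≃o I,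
      supDev e ≤ ENNReal.ofReal r ∧ unifDist x (y ∘ e) < ε := fun r hr ε hε => by
    obtain ⟨δ, hδ, H⟩ := hN.supDev_lt r hr
    obtain ⟨e, he, he'⟩ := timeChangeDist_lt_iff.1 (h.trans_lt (lt_min hδ hε))
    exact ⟨e, H e (he.trans_le (min_le_left _ _)), he'.trans_le (min_le_right _ _)⟩
  refine Cadlag.ext (funext fun t => edist_le_zero.1 ?_)
  refine ENNReal.le_of_forall_pos_le_add fun ε hε _ => ?_
  rw [zero_add]
  have hε3 : (0 : ℝ≥0∞) < ε / 3 := by simpa using hε.ne'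
  rcases eq_or_lt_of_le (unitInterval.le_one' (t := t)) with rfl | ht
  · obtain ⟨e, -, he⟩ := happ 1 one_pos ε (by simpa using hε)
    have h1 : e 1 = 1 := e.map_top
    have := (edist_le_unifDist x (y ∘ e) 1).trans he.le
    rwa [Function.comp_apply, h1] at this
  · have hx : ∀ᶠ s in 𝓝[≥] t, edist (x s) (x t) < ε / 3 :=
      (x.right_continuous t).eventually (gt_mem_nhds hε3)
    have hy : ∀ᶠ s in 𝓝[≥] t, edist (y s) (y t) < ε / 3 :=
      (y.right_continuous t).eventually (gt_mem_nhds hε3)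
    obtain ⟨b, hb, hb'⟩ := (mem_nhdsGE_iff_exists_Ico_subset' ht).1 (hx.and hy)
    obtain ⟨s, hs1, hs2⟩ := exists_between (Set.mem_Ioi.1 hb)
    have h1 : (t : ℝ) < s := hs1
    have h2 : (s : ℝ) < b := hs2
    -- A deviation below both distances from `s` to the ends of `[t, b)` keeps `e s` inside.
    obtain ⟨e, he, he'⟩ := happ (min ((s - t) / 2) ((b - s) / 2))
      (lt_min (by linarith) (by linarith)) (ε / 3) hε3
    have hd := abs_le.1 (abs_sub_le_of_supDev_le
      (le_min (by linarith) (by linarith)) he s)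
    have hm1 := min_le_left (((s : ℝ) - t) / 2) ((b - s) / 2)
    have hm2 := min_le_right (((s : ℝ) - t) / 2) ((b - s) / 2)
    have hes : e s ∈ Set.Ico t b := by
      constructor
      · change (t : ℝ) ≤ e s
        linarith
      · change (e s : ℝ) < b
        linarith
    have e1 := (hb' ⟨hs1.le, hs2⟩).1.le
    have e2 := (hb' hes).2.le
    have e3 := (edist_le_unifDist x (y ∘ e) s).trans he'.le
    calc edist (x t) (y t) ≤ edist (x t) (x s) + edist (x s) (y (e s)) + edist (y (e s)) (y t) :=
          edist_triangle4 _ _ _ _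
      _ ≤ ε / 3 + ε / 3 + ε / 3 := add_le_add (add_le_add (by rwa [edist_comm]) e3) e2
      _ = ε := ENNReal.add_thirds _

end Tendsto

/-- `d` as an extended metric. -/
@[reducible]
noncomputable def skorokhodEMetric (S : Type*) [EMetricSpace S] : EMetricSpace (Cadlag S) where
  edist := skorokhodDist
  edist_self x := by
    rw [skorokhodDist_eq]; exact timeChangeDist_self isLength_supDev x
  edist_comm x y := by
    rw [skorokhodDist_eq, skorokhodDist_eq]; exact timeChangeDist_comm isLength_supDev x y
  edist_triangle x y z := by
    simp only [skorokhodDist_eq]; exact timeChangeDist_triangle isLength_supDev x y z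
  eq_of_edist_eq_zero {x y} h := by
    rw [skorokhodDist_eq] at h; exact eq_of_timeChangeDist_eq_zero isLength_supDev h

/-- `d⁰` as an extended metric. -/
noncomputable instance {S : Type*} [EMetricSpace S] : EMetricSpace (Cadlag S) where
  edist := skorokhodDist0
  edist_self x := by
    rw [skorokhodDist0_eq]; exact timeChangeDist_self isLength_logDev x
  edist_comm x y := by
    rw [skorokhodDist0_eq, skorokhodDist0_eq]; exact timeChangeDist_comm isLength_logDev x y
  edist_triangle x y z := by
    simp only [skorokhodDist0_eq]; exact timeChangeDist_triangle isLength_logDev x y z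
  eq_of_edist_eq_zero {x y} h := by
    rw [skorokhodDist0_eq] at h; exact eq_of_timeChangeDist_eq_zero isLength_logDev h

theorem edist_eq {S : Type*} [EMetricSpace S] (x y : Cadlag S) :
    edist x y = timeChangeDist logDev x y :=
  skorokhodDist0_eq x y

/-- `t 0 < t 1 < ⋯ < t k` are points of `[0,1]` with `t 0 = 0`. -/
structure IsSubdivision (k : ℕ) (t : ℕ → I) : Prop where
  zero : t 0 = 0
  lt_succ : ∀ i < k, t i < t (i + 1)

/-- The oscillation of `x` on each `[t i, t (i + 1))`, `i < k`, is at most `ε`. -/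
def OscLE {S : Type*} [EDist S] (x : I → S) (k : ℕ) (t : ℕ → I) (ε : ℝ≥0∞) : Prop :=
  ∀ i < k, ∀ s ∈ Set.Ico (t i) (t (i + 1)), ∀ s' ∈ Set.Ico (t i) (t (i + 1)),
    edist (x s) (x s') ≤ ε

theorem IsSubdivision.exists_mem_Ico {k : ℕ} {t : ℕ → I} (ht : IsSubdivision k t) {s : I}
    (hs : s < t k) : ∃ i < k, s ∈ Set.Ico (t i) (t (i + 1)) := by
  induction k with
  | zero => rw [ht.zero] at hs; exact absurd hs (not_lt.2 unitInterval.nonneg')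
  | succ k ih =>
    rcases lt_or_ge s (t k) with h | h
    · obtain ⟨i, hi, hi'⟩ := ih ⟨ht.zero, fun i hi => ht.lt_succ i (hi.trans k.lt_succ_self)⟩ h
      exact ⟨i, hi.trans k.lt_succ_self, hi'⟩
    · exact ⟨k, k.lt_succ_self, h, hs⟩

/-! ### Subdivisions with small oscillation, and finiteness -/

section Partition

theorem nhdsLT_zero : 𝓝[<] (0 : I) = ⊥ := by
  have : Set.Iio (0 : I) = ∅ := Set.eq_empty_of_forall_notMem fun s hs =>
    not_le.2 hs unitInterval.nonneg'
  rw [this, nhdsWithin_empty]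

variable {S : Type*} [EMetricSpace S]

theorem IsSubdivision.append {x : I → S} {k : ℕ} {t : ℕ → I} {ε : ℝ≥0∞}
    (ht : IsSubdivision k t) (hx : OscLE x k t ε) {b : I} (hb : t k < b)
    (hxb : ∀ s ∈ Set.Ico (t k) b, ∀ s' ∈ Set.Ico (t k) b, edist (x s) (x s') ≤ ε) :
    ∃ t' : ℕ → I, IsSubdivision (k + 1) t' ∧ t' (k + 1) = b ∧ OscLE x (k + 1) t' ε := by
  refine ⟨fun i => if i ≤ k then t i else b, ⟨by simp [ht.zero], fun i hi => ?_⟩, by simp,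
    fun i hi => ?_⟩
  · rcases Nat.lt_succ_iff_lt_or_eq.1 hi with h | rfl
    · simpa [h.le, Nat.succ_le_of_lt h] using ht.lt_succ i h
    · simpa using hb
  · rcases Nat.lt_succ_iff_lt_or_eq.1 hi with h | rfl
    · simpa only [h.le, Nat.succ_le_of_lt h, if_true] using hx i h
    · simpa using hxb

theorem exists_Ico_osc_le_right (x : Cadlag S) {ε : ℝ≥0∞} (hε : 0 < ε) {t : I} (ht : t < 1) :
    ∃ b, t < b ∧ ∀ s ∈ Set.Ico t b, ∀ s' ∈ Set.Ico t b, edist (x s) (x s') ≤ ε := by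
  have hx : ∀ᶠ s in 𝓝[≥] t, edist (x s) (x t) < ε / 2 :=
    (x.right_continuous t).eventually (gt_mem_nhds (ENNReal.half_pos hε.ne'))
  obtain ⟨b, hb, hb'⟩ := (mem_nhdsGE_iff_exists_Ico_subset' ht).1 hx
  refine ⟨b, hb, fun s hs s' hs' => ?_⟩
  calc _ ≤ edist (x s) (x t) + edist (x s') (x t) := edist_triangle_right _ _ _
    _ ≤ ε / 2 + ε / 2 := add_le_add (hb' hs).le (hb' hs').le
    _ = ε := ENNReal.add_halves _

theorem exists_Ioo_osc_le_left (x : Cadlag S) {ε : ℝ≥0∞} (hε : 0 < ε) {t : I} (ht : 0 < t) :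
    ∃ a, a < t ∧ ∀ s ∈ Set.Ioo a t, ∀ s' ∈ Set.Ioo a t, edist (x s) (x s') ≤ ε := by
  obtain ⟨l, hl⟩ := x.left_limits t
  have hx : ∀ᶠ s in 𝓝[<] t, edist (x s) l < ε / 2 :=
    hl.eventually (gt_mem_nhds (ENNReal.half_pos hε.ne'))
  obtain ⟨a, ha, ha'⟩ := (mem_nhdsLT_iff_exists_Ioo_subset' ht).1 hx
  refine ⟨a, ha, fun s hs s' hs' => ?_⟩
  calc _ ≤ edist (x s) l + edist (x s') l := edist_triangle_right _ _ _
    _ ≤ ε / 2 + ε / 2 := add_le_add (ha' hs).le (ha' hs').le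
    _ = ε := ENNReal.add_halves _

/-- A càdlàg function has a subdivision of `[0,1]` with small oscillation between its points. -/
theorem exists_subdivision (x : Cadlag S) {ε : ℝ≥0∞} (hε : 0 < ε) :
    ∃ (k : ℕ) (t : ℕ → I), IsSubdivision k t ∧ t k = 1 ∧ OscLE x k t ε := by
  -- `A` is the set of points up to which a good subdivision exists. Left limits show that it
  -- contains its supremum; right continuity shows that this supremum cannot be less than `1`.
  set A : Set I := {b | ∃ (k : ℕ) (t : ℕ → I), IsSubdivision k t ∧ t k = b ∧ OscLE x k t ε}
  have h0 : (0 : I) ∈ A := ⟨0, fun _ => 0, ⟨rfl, by simp⟩, rfl, fun i hi => by simp at hi⟩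
  have hstep : ∀ a ∈ A, ∀ b, a < b →
      (∀ s ∈ Set.Ico a b, ∀ s' ∈ Set.Ico a b, edist (x s) (x s') ≤ ε) → b ∈ A := by
    rintro _ ⟨k, t, ht, rfl, hx⟩ b hab hxb
    obtain ⟨t', h1, h2, h3⟩ := ht.append hx hab hxb
    exact ⟨k + 1, t', h1, h2, h3⟩
  obtain ⟨r, hr⟩ : ∃ r, IsLUB A r := by
    obtain ⟨r, -, hr⟩ := isClosed_closure.isCompact.exists_isLUB (s := closure A)
      ⟨0, subset_closure h0⟩
    exact ⟨r, fun b hb => hr.1 (subset_closure hb),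
      fun b hb => hr.2 (closure_minimal (fun a ha => hb ha) isClosed_Iic)⟩
  have hrA : r ∈ A := by
    rcases eq_or_lt_of_le (unitInterval.nonneg' (t := r)) with rfl | h
    · exact h0
    · obtain ⟨a, ha, hxa⟩ := exists_Ioo_osc_le_left x hε h
      obtain ⟨b, hbA, hab, hbr⟩ := hr.exists_between ha
      rcases eq_or_lt_of_le hbr with rfl | hlt
      · exact hbA
      · exact hstep b hbA r hlt fun s hs s' hs' =>
          hxa s ⟨hab.trans_le hs.1, hs.2⟩ s' ⟨hab.trans_le hs'.1, hs'.2⟩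
  rcases eq_or_lt_of_le (unitInterval.le_one' (t := r)) with rfl | h
  · exact hrA
  · obtain ⟨b, hb, hxb⟩ := exists_Ico_osc_le_right x hε h
    exact absurd (hr.1 (hstep r hrA b hb hxb)) (not_le.2 hb)

/-- A time change that fixes the points of a subdivision moves `x` at most by its oscillation. -/
theorem unifDist_comp_le {x : I → S} {k : ℕ} {t : ℕ → I} {ε : ℝ≥0∞}
    (ht : IsSubdivision k t) (hk : t k = 1) (hx : OscLE x k t ε) (e : I ≃o I)
    (he : ∀ i ≤ k, e (t i) = t i) : unifDist x (x ∘ e) ≤ ε := by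
  refine iSup_le fun s => ?_
  rcases eq_or_lt_of_le (unitInterval.le_one' (t := s)) with rfl | hs
  · have h1 : e 1 = 1 := e.map_top
    simp [h1]
  · rw [← hk] at hs
    obtain ⟨i, hi, hsi⟩ := ht.exists_mem_Ico hs
    refine hx i hi s hsi (e s) ⟨?_, ?_⟩
    · rw [← he i hi.le]; exact e.monotone hsi.1
    · rw [← he (i + 1) hi]; exact e.strictMono hsi.2

/-- The range of a càdlàg function is bounded. -/
theorem unifDist_ne_top (hS : ∀ a b : S, edist a b ≠ ⊤) (x y : Cadlag S) :
    unifDist x y ≠ ⊤ := by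
  -- Up to an error of 1, `x` takes only the finitely many values `x (t i)` on `[0, 1)`.
  have key : ∀ x : Cadlag S, unifDist x (fun _ => x 1) ≠ ⊤ := fun x => by
    obtain ⟨k, t, ht, hk, hx⟩ := exists_subdivision x one_pos
    have hsup : (Finset.range k).sup (fun i => edist (x (t i)) (x 1)) < ⊤ :=
      (Finset.sup_lt_iff ENNReal.zero_lt_top).2 fun i _ => (hS _ _).lt_top
    refine ne_top_of_le_ne_top (ENNReal.add_ne_top.2 ⟨ENNReal.one_ne_top, hsup.ne⟩)
      (iSup_le fun s => ?_)
    rcases eq_or_lt_of_le (unitInterval.le_one' (t := s)) with rfl | hs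
    · simp
    · rw [← hk] at hs
      obtain ⟨i, hi, hsi⟩ := ht.exists_mem_Ico hs
      exact (edist_triangle _ (x (t i)) _).trans (add_le_add
        (hx i hi s hsi (t i) ⟨le_rfl, ht.lt_succ i hi⟩)
        (Finset.le_sup (f := fun i => edist (x (t i)) (x 1)) (Finset.mem_range.2 hi)))
  have hc : unifDist (fun _ => x 1) (fun _ => y 1) ≠ ⊤ := by
    simpa [unifDist] using hS (x 1) (y 1)
  refine ne_top_of_le_ne_top ?_ ((unifDist_triangle _ (fun _ => x 1) _).trans
    (add_le_add_right (unifDist_triangle _ (fun _ => y 1) _) _))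
  rw [unifDist_comm _ (y : I → S)]
  exact ENNReal.add_ne_top.2 ⟨key x, ENNReal.add_ne_top.2 ⟨hc, key y⟩⟩

theorem timeChangeDist_ne_top {N : (I → I) → ℝ≥0∞} (hN : IsLength N)
    (hS : ∀ a b : S, edist a b ≠ ⊤) (x y : Cadlag S) : timeChangeDist N x y ≠ ⊤ :=
  ne_top_of_le_ne_top (unifDist_ne_top hS x y)
    (timeChangeDist_le (OrderIso.refl I) (hN.refl.le.trans zero_le) le_rfl)

end Partition

/-! ### Piecewise linear time changes -/

section Interpolation

/-- A function with slopes in `[a, b]`, `a > 0`, that fixes `0` and `1` is a time change. -/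
theorem exists_orderIso_of_slope_bounds {G : I → I} {a b : ℝ} (ha : 0 < a) (h0 : G 0 = 0)
    (h1 : G 1 = 1)
    (h : ∀ s t : I, s < t → a * ((t : ℝ) - s) ≤ (G t : ℝ) - G s ∧
      (G t : ℝ) - G s ≤ b * ((t : ℝ) - s)) : ∃ e : I ≃o I, ⇑e = G := by
  have hmono : StrictMono G := fun s t hst => by
    have h2 : (0 : ℝ) < (t : ℝ) - s := sub_pos.2 hst
    have h3 := (h s t hst).1
    have h4 := mul_pos ha h2
    change (G s : ℝ) < G t
    linarith
  have hlip : LipschitzWith b.toNNReal G := LipschitzWith.of_dist_le_mul fun s t => by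
    have key : ∀ s t : I, s < t → dist (G s) (G t) ≤ b.toNNReal * dist s t := fun s t hst => by
      have h2 : (0 : ℝ) < (t : ℝ) - s := sub_pos.2 hst
      have h3 : (0 : ℝ) < (G t : ℝ) - G s := sub_pos.2 (hmono hst)
      rw [dist_comm, dist_comm s, Subtype.dist_eq, Subtype.dist_eq, Real.dist_eq, Real.dist_eq,
        abs_of_pos h2, abs_of_pos h3]
      exact (h s t hst).2.trans (mul_le_mul_of_nonneg_right (Real.le_coe_toNNReal b) h2.le)
    rcases lt_trichotomy s t with hst | rfl | hst
    · exact key s t hst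
    · simp
    · rw [dist_comm, dist_comm s]; exact key t s hst
  have hsurj : Function.Surjective G := fun y => by
    have := intermediate_value_Icc (zero_le_one' I) hlip.continuous.continuousOn
    rw [h0, h1] at this
    obtain ⟨s, -, hs⟩ := this ⟨unitInterval.nonneg', unitInterval.le_one'⟩
    exact ⟨s, hs⟩
  exact ⟨hmono.orderIsoOfSurjective G hsurj, rfl⟩

/-- The piecewise linear function through the points `(t i, u i)`, `i ≤ k`, where `t 0 = u 0 = 0`. -/
noncomputable def piecewiseLinear (k : ℕ) (t u : ℕ → I) (s : ℝ) : ℝ :=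
  ∑ i ∈ Finset.range k, ((u (i + 1) : ℝ) - u i) / ((t (i + 1) : ℝ) - t i) *
    (min s (t (i + 1)) - min s (t i))

theorem IsSubdivision.strictMonoOn {k : ℕ} {t : ℕ → I} (ht : IsSubdivision k t) :
    ∀ j ≤ k, ∀ i < j, t i < t j := by
  intro j
  induction j with
  | zero => intro _ i hi; simp at hi
  | succ j ih =>
    intro hj i hi
    rcases Nat.lt_succ_iff_lt_or_eq.1 hi with h | rfl
    · exact (ih (Nat.le_of_succ_le hj) i h).trans (ht.lt_succ j hj)
    · exact ht.lt_succ i hj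

theorem IsSubdivision.monotoneOn {k : ℕ} {t : ℕ → I} (ht : IsSubdivision k t) {i j : ℕ}
    (hj : j ≤ k) (hij : i ≤ j) : t i ≤ t j := by
  rcases eq_or_lt_of_le hij with rfl | h
  · exact le_rfl
  · exact (ht.strictMonoOn j hj i h).le

/-- The difference of minima in each summand is the length of the part of the cell to the left of
the argument. At `t j` it is the full cell or zero, and the sum telescopes. -/
theorem piecewiseLinear_apply {k : ℕ} {t u : ℕ → I} (ht : IsSubdivision k t) (hu : u 0 = 0)
    {j : ℕ} (hj : j ≤ k) : piecewiseLinear k t u (t j) = u j := by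
  have hterm : ∀ i ∈ Finset.range k, ((u (i + 1) : ℝ) - u i) / ((t (i + 1) : ℝ) - t i) *
      (min (t j : ℝ) (t (i + 1)) - min (t j : ℝ) (t i)) =
      if i < j then (u (i + 1) : ℝ) - u i else 0 := fun i hi => by
    have hik := Finset.mem_range.1 hi
    have h0 : (t i : ℝ) < t (i + 1) := ht.lt_succ i hik
    split_ifs with hij
    · have h1 : (t (i + 1) : ℝ) ≤ t j := ht.monotoneOn hj hij
      rw [min_eq_right h1, min_eq_right (h0.le.trans h1), div_mul_cancel₀ _ (by linarith)]
    · have h1 : (t j : ℝ) ≤ t i := ht.monotoneOn hik.le (not_lt.1 hij)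
      rw [min_eq_left h1, min_eq_left (h1.trans h0.le), sub_self, mul_zero]
  rw [piecewiseLinear, Finset.sum_congr rfl hterm, ← Finset.sum_filter]
  have : (Finset.range k).filter (· < j) = Finset.range j := by
    ext i; simp only [Finset.mem_filter, Finset.mem_range]; omega
  rw [this, Finset.sum_range_sub (fun i => (u i : ℝ)), hu]
  simp

/-- The increment is the sum of the cell slopes weighted by the lengths of `[s, s']` in the cells;
these weights are nonnegative and add up to `s' - s`. -/
theorem piecewiseLinear_sub_bounds {k : ℕ} {t u : ℕ → I} (ht : IsSubdivision k t)
    (hk : t k = 1) {a b : ℝ}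
    (h : ∀ i < k, a * ((t (i + 1) : ℝ) - t i) ≤ (u (i + 1) : ℝ) - u i ∧
      (u (i + 1) : ℝ) - u i ≤ b * ((t (i + 1) : ℝ) - t i)) (s s' : I) (hs : s < s') :
    a * ((s' : ℝ) - s) ≤ piecewiseLinear k t u s' - piecewiseLinear k t u s ∧
      piecewiseLinear k t u s' - piecewiseLinear k t u s ≤ b * ((s' : ℝ) - s) := by
  have hs' : (s : ℝ) < s' := hs
  have hnn : ∀ i < k, 0 ≤ (min (s' : ℝ) (t (i + 1)) - min (s' : ℝ) (t i)) -
      (min (s : ℝ) (t (i + 1)) - min (s : ℝ) (t i)) := fun i hi => by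
    have h0 : (t i : ℝ) < t (i + 1) := ht.lt_succ i hi
    rcases min_cases (s' : ℝ) (t (i + 1)) with h1 | h1 <;>
    rcases min_cases (s' : ℝ) (t i) with h2 | h2 <;>
    rcases min_cases (s : ℝ) (t (i + 1)) with h3 | h3 <;>
    rcases min_cases (s : ℝ) (t i) with h4 | h4 <;> linarith
  have htel : (s' : ℝ) - s = ∑ i ∈ Finset.range k,
      ((min (s' : ℝ) (t (i + 1)) - min (s' : ℝ) (t i)) -
        (min (s : ℝ) (t (i + 1)) - min (s : ℝ) (t i))) := by
    rw [Finset.sum_sub_distrib, Finset.sum_range_sub (fun i => min (s' : ℝ) (t i)),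
      Finset.sum_range_sub (fun i => min (s : ℝ) (t i)), hk, ht.zero]
    simp [s.2.1, s.2.2, s'.2.1, s'.2.2]
  have hdiff : piecewiseLinear k t u s' - piecewiseLinear k t u s = ∑ i ∈ Finset.range k,
      ((u (i + 1) : ℝ) - u i) / ((t (i + 1) : ℝ) - t i) *
      ((min (s' : ℝ) (t (i + 1)) - min (s' : ℝ) (t i)) -
        (min (s : ℝ) (t (i + 1)) - min (s : ℝ) (t i))) := by
    rw [piecewiseLinear, piecewiseLinear, ← Finset.sum_sub_distrib]
    exact Finset.sum_congr rfl fun i _ => by ring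
  rw [hdiff, htel, Finset.mul_sum, Finset.mul_sum]
  constructor <;> refine Finset.sum_le_sum fun i hi => ?_ <;>
    refine mul_le_mul_of_nonneg_right ?_ (hnn i (Finset.mem_range.1 hi))
  · have h0 : (0 : ℝ) < t (i + 1) - t i := sub_pos.2 (ht.lt_succ i (Finset.mem_range.1 hi))
    rw [le_div_iff₀ h0]
    exact (h i (Finset.mem_range.1 hi)).1
  · have h0 : (0 : ℝ) < t (i + 1) - t i := sub_pos.2 (ht.lt_succ i (Finset.mem_range.1 hi))
    rw [div_le_iff₀ h0]
    exact (h i (Finset.mem_range.1 hi)).2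

theorem exists_orderIso_interpolating {k : ℕ} {t u : ℕ → I} (ht : IsSubdivision k t)
    (hk : t k = 1) (hu0 : u 0 = 0) (huk : u k = 1) {c : ℝ} (hc : 0 ≤ c)
    (h : ∀ i < k, Real.exp (-c) * ((t (i + 1) : ℝ) - t i) ≤ (u (i + 1) : ℝ) - u i ∧
      (u (i + 1) : ℝ) - u i ≤ Real.exp c * ((t (i + 1) : ℝ) - t i)) :
    ∃ e : I ≃o I, (∀ i ≤ k, e (t i) = u i) ∧ logDev e ≤ ENNReal.ofReal c := by
  have hb := piecewiseLinear_sub_bounds ht hk h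
  have h0 : piecewiseLinear k t u (0 : I) = 0 := by
    have := piecewiseLinear_apply ht hu0 k.zero_le
    rwa [ht.zero, hu0] at this
  have h1 : piecewiseLinear k t u (1 : I) = 1 := by
    have := piecewiseLinear_apply ht hu0 (le_refl k)
    rwa [hk, huk] at this
  have hmono : ∀ s s' : I, s ≤ s' → piecewiseLinear k t u s ≤ piecewiseLinear k t u s' :=
    fun s s' hs => by
      rcases eq_or_lt_of_le hs with rfl | hs
      · exact le_rfl
      · have h2 : (0 : ℝ) < (s' : ℝ) - s := sub_pos.2 hs
        have h3 := (hb s s' hs).1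
        have h4 := mul_pos (Real.exp_pos (-c)) h2
        linarith
  let G : I → I := fun s => ⟨piecewiseLinear k t u s,
    h0 ▸ hmono 0 s unitInterval.nonneg', h1 ▸ hmono s 1 unitInterval.le_one'⟩
  obtain ⟨e, he⟩ := exists_orderIso_of_slope_bounds (G := G) (Real.exp_pos (-c))
    (Subtype.ext h0) (Subtype.ext h1) hb
  refine ⟨e, fun i hi => ?_, (logDev_le_iff e.strictMono hc).2 ?_⟩
  · rw [he]
    exact Subtype.ext (piecewiseLinear_apply ht hu0 hi)
  · rw [he]; exact hb

/-- Moving the points of a subdivision a little costs little in `‖·‖⁰`. -/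
theorem exists_orderIso_of_near {k : ℕ} {t : ℕ → I} (ht : IsSubdivision k t) (hk : t k = 1)
    {c : ℝ} (hc : 0 < c) :
    ∃ η : ℝ, 0 < η ∧ ∀ u : ℕ → I, u 0 = 0 → u k = 1 → (∀ i ≤ k, |(u i : ℝ) - t i| ≤ η) →
      ∃ e : I ≃o I, (∀ i ≤ k, e (t i) = u i) ∧ logDev e ≤ ENNReal.ofReal c := by
  obtain ⟨δ, hδ, hgap⟩ : ∃ δ : ℝ, 0 < δ ∧ ∀ i < k, δ ≤ (t (i + 1) : ℝ) - t i := by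
    have hpos : ∀ i ∈ Finset.range k, (0 : ℝ) < (t (i + 1) : ℝ) - t i := fun i hi =>
      sub_pos.2 (ht.lt_succ i (Finset.mem_range.1 hi))
    rcases (Finset.range k).eq_empty_or_nonempty with h | h
    · exact ⟨1, one_pos, fun i hi => by simp_all⟩
    · obtain ⟨j, hj, hmin⟩ := Finset.exists_min_image _ (fun i => (t (i + 1) : ℝ) - t i) h
      exact ⟨_, hpos j hj, fun i hi => hmin i (Finset.mem_range.2 hi)⟩
  have hexp : Real.exp (-c) < 1 := Real.exp_lt_one_iff.2 (by linarith)
  -- Both ends of a cell may move by this amount, so its length changes by at most the fraction `1 -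
  -- exp (-c)`. This also suffices for the upper bound, as `1 - exp (-c) ≤ exp c - 1`.
  refine ⟨δ * (1 - Real.exp (-c)) / 2, by have := mul_pos hδ (sub_pos.2 hexp); linarith,
    fun u hu0 huk hu => ?_⟩
  refine exists_orderIso_interpolating ht hk hu0 huk hc.le fun i hi => ?_
  have hsum : 2 ≤ Real.exp c + Real.exp (-c) := by
    have h1 := Real.add_one_le_exp c
    have h2 := Real.add_one_le_exp (-c)
    linarith
  have h1 := abs_le.1 (hu i hi.le)
  have h2 := abs_le.1 (hu (i + 1) hi)
  have h3 := hgap i hi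
  have h4 : δ * (1 - Real.exp (-c)) ≤ ((t (i + 1) : ℝ) - t i) * (1 - Real.exp (-c)) :=
    mul_le_mul_of_nonneg_right h3 (sub_nonneg.2 hexp.le)
  have h5 : ((t (i + 1) : ℝ) - t i) * 2 ≤ ((t (i + 1) : ℝ) - t i) * (Real.exp c + Real.exp (-c)) :=
    mul_le_mul_of_nonneg_left hsum (hδ.le.trans h3)
  constructor <;> linarith

end Interpolation

/-! ### Equivalence of the two distances -/

section Topology

variable {S : Type*} [EMetricSpace S]

/-- Let `f` interpolate `e` linearly at the points of a subdivision adapted to `x`. Then `e⁻¹ ∘ f`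
fixes these points, so it changes `x` by at most the oscillation, while `x ∘ e⁻¹ ∘ f` is as close to
`y ∘ f` as `x` is to `y ∘ e`. The subdivision makes `δ` depend on `x`. -/
theorem exists_timeChangeDist_logDev_lt (x : Cadlag S) {ε : ℝ≥0∞} (hε : 0 < ε) :
    ∃ δ : ℝ≥0∞, 0 < δ ∧ ∀ y : Cadlag S, timeChangeDist supDev x y < δ →
      timeChangeDist logDev x y < ε := by
  obtain ⟨c, hc0, hcε⟩ := ENNReal.lt_iff_exists_nnreal_btwn.1 hε
  have hc2 : (0 : ℝ≥0∞) < c / 2 := ENNReal.half_pos hc0.ne'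
  have hc : (0 : ℝ) < c := by exact_mod_cast hc0
  obtain ⟨k, t, ht, hk, hx⟩ := exists_subdivision x hc2
  obtain ⟨η, hη, H⟩ := exists_orderIso_of_near ht hk hc
  refine ⟨min (ENNReal.ofReal η) (c / 2), lt_min (by simpa using hη) hc2, fun y hy => ?_⟩
  obtain ⟨e, he, he'⟩ := timeChangeDist_lt_iff.1 hy
  obtain ⟨f, hf, hf'⟩ := H (fun i => e (t i)) (by rw [ht.zero]; exact e.map_bot)
    (by rw [hk]; exact e.map_top) fun i _ =>
      abs_sub_le_of_supDev_le hη.le (he.trans_le (min_le_left _ _)).le (t i)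
  rw [ENNReal.ofReal_coe_nnreal] at hf'
  refine (timeChangeDist_le f hf' ?_).trans_lt hcε
  have h1 : unifDist x (x ∘ f.trans e.symm) ≤ c / 2 :=
    unifDist_comp_le ht hk hx _ fun i hi => by simp [hf i hi]
  have h2 : unifDist (x ∘ f.trans e.symm) (y ∘ f) ≤ c / 2 := by
    refine le_trans (le_of_eq ?_) (he'.trans_le (min_le_right _ _)).le
    rw [← unifDist_comp_equiv (x : I → S) _ (f.trans e.symm).toEquiv]
    congr 1
    ext s
    simp
  calc unifDist x (y ∘ f) ≤ _ := unifDist_triangle _ (x ∘ f.trans e.symm) _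
    _ ≤ c / 2 + c / 2 := add_le_add h1 h2
    _ = c := ENNReal.add_halves _

theorem exists_timeChangeDist_supDev_lt {ε : ℝ≥0∞} (hε : 0 < ε) :
    ∃ δ : ℝ≥0∞, 0 < δ ∧ ∀ x y : Cadlag S, timeChangeDist logDev x y < δ →
      timeChangeDist supDev x y < ε := by
  obtain ⟨c, hc0, hcε⟩ := ENNReal.lt_iff_exists_nnreal_btwn.1 hε
  obtain ⟨δ, hδ, H⟩ := isLength_logDev.supDev_lt c (by exact_mod_cast hc0)
  refine ⟨min δ c, lt_min hδ hc0, fun x y hxy => ?_⟩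
  obtain ⟨e, he, he'⟩ := timeChangeDist_lt_iff.1 hxy
  have h1 := H e (he.trans_le (min_le_left _ _))
  rw [ENNReal.ofReal_coe_nnreal] at h1
  exact (timeChangeDist_le e h1 (he'.trans_le (min_le_right _ _)).le).trans_lt hcε

end Topology

theorem toTopologicalSpace_le_of_edist {X : Type*} (m₁ m₂ : EMetricSpace X)
    (h : ∀ (x : X) (ε : ℝ≥0∞), 0 < ε → ∃ δ : ℝ≥0∞, 0 < δ ∧
      ∀ y, m₁.edist x y < δ → m₂.edist x y < ε) :
    m₁.toUniformSpace.toTopologicalSpace ≤ m₂.toUniformSpace.toTopologicalSpace := by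
  refine le_of_nhds_le_nhds fun x => ?_
  refine tendsto_id'.1 ((@EMetric.tendsto_nhds_nhds X X m₁.toPseudoEMetricSpace m₂.toPseudoEMetricSpace
    id x x).2 fun ε hε => ?_)
  obtain ⟨δ, hδ, H⟩ := h x ε hε
  refine ⟨δ, hδ, fun y hy => ?_⟩
  rw [m₁.edist_comm] at hy
  change m₂.edist y x < ε
  rw [m₂.edist_comm]
  exact H y hy

/-- `d` and `d⁰` induce the same topology. -/
theorem skorokhodEMetric_topology_eq {S : Type*} [EMetricSpace S] :
    (skorokhodEMetric S).toUniformSpace.toTopologicalSpace =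
      (inferInstance : EMetricSpace (Cadlag S)).toUniformSpace.toTopologicalSpace := by
  apply le_antisymm
  · refine toTopologicalSpace_le_of_edist (skorokhodEMetric S) inferInstance fun x ε hε => ?_
    obtain ⟨δ, hδ, H⟩ := exists_timeChangeDist_logDev_lt x hε
    refine ⟨δ, hδ, fun y hy => ?_⟩
    have := H y ((skorokhodDist_eq x y).symm.trans_lt hy)
    exact (skorokhodDist0_eq x y).trans_lt this
  · refine toTopologicalSpace_le_of_edist inferInstance (skorokhodEMetric S) fun x ε hε => ?_
    obtain ⟨δ, hδ, H⟩ := exists_timeChangeDist_supDev_lt (S := S) hε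
    refine ⟨δ, hδ, fun y hy => ?_⟩
    have := H x y ((skorokhodDist0_eq x y).symm.trans_lt hy)
    exact (skorokhodDist_eq x y).trans_lt this

/-! ### Separability -/

section Separable

/-- The function with value `f i` on `[i / (n + 1), (i + 1) / (n + 1))`. -/
noncomputable def step {S : Type*} [EMetricSpace S] (n : ℕ) (f : ℕ → S) : Cadlag S where
  toFun t := f ⌊((n : ℝ) + 1) * t⌋₊
  right_continuous t := by
    refine tendsto_const_nhds.congr' ?_
    have ho : IsOpen {s : I | ((n : ℝ) + 1) * s < ⌊((n : ℝ) + 1) * t⌋₊ + 1} :=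
      isOpen_lt (by fun_prop) (by fun_prop)
    filter_upwards [self_mem_nhdsWithin, mem_nhdsWithin_of_mem_nhds
      (ho.mem_nhds (x := t) (Nat.lt_floor_add_one (((n : ℝ) + 1) * t)))] with s hs hs'
    have hts : (t : ℝ) ≤ s := hs
    have ht0 : (0 : ℝ) ≤ t := t.2.1
    have hs0 : (0 : ℝ) ≤ s := s.2.1
    have : ⌊((n : ℝ) + 1) * s⌋₊ = ⌊((n : ℝ) + 1) * t⌋₊ := by
      rw [Nat.floor_eq_iff (by positivity)]
      exact ⟨(Nat.floor_le (by positivity)).trans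
        (mul_le_mul_of_nonneg_left hts (by positivity)), hs'⟩
    rw [this, edist_self]
  left_limits t := by
    rcases eq_or_lt_of_le (unitInterval.nonneg' (t := t)) with rfl | ht
    · exact ⟨f 0, by rw [nhdsLT_zero]; exact tendsto_bot⟩
    have ht0 : (0 : ℝ) < t := ht
    -- `c` is the largest integer strictly below `(n + 1) * t`; at a grid point it indexes the
    -- preceding cell, unlike the floor.
    obtain ⟨c, hc⟩ : ∃ c, ⌈((n : ℝ) + 1) * t⌉₊ = c + 1 :=
      Nat.exists_eq_add_one.2 (Nat.ceil_pos.2 (by positivity))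
    have hct : (c : ℝ) < ((n : ℝ) + 1) * t := Nat.lt_ceil.1 (by omega)
    refine ⟨f c, tendsto_const_nhds.congr' ?_⟩
    have ho : IsOpen {s : I | (c : ℝ) < ((n : ℝ) + 1) * s} :=
      isOpen_lt (by fun_prop) (by fun_prop)
    filter_upwards [self_mem_nhdsWithin, mem_nhdsWithin_of_mem_nhds
      (ho.mem_nhds hct)] with s hs hs'
    have hts : (s : ℝ) < t := hs
    have hs0 : (0 : ℝ) ≤ s := s.2.1
    have h1 : ((n : ℝ) + 1) * s < ((n : ℝ) + 1) * t :=
      mul_lt_mul_of_pos_left hts (by positivity)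
    have h2 : ((n : ℝ) + 1) * t ≤ c + 1 := by
      have := Nat.le_ceil (((n : ℝ) + 1) * t)
      rw [hc] at this
      exact_mod_cast this
    have : ⌊((n : ℝ) + 1) * s⌋₊ = c := by
      rw [Nat.floor_eq_iff (by positivity)]
      exact ⟨le_of_lt hs', h1.trans_le h2⟩
    rw [this, edist_self]

variable {S : Type*} [EMetricSpace S]

/-- The step functions on regular grids come close to every càdlàg function in `d⁰`; the values
may be prescribed up to a small error. -/
theorem exists_step_near (x : Cadlag S) {c : ℝ} (hc : 0 < c) {ε : ℝ≥0∞} (hε : 0 < ε) :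
    ∃ (n : ℕ) (v : ℕ → S), ∀ f : ℕ → S, (∀ i ≤ n + 1, edist (v i) (f i) ≤ ε) →
      timeChangeDist logDev x (step n f) ≤ ENNReal.ofReal c ⊔ (ε + ε) := by
  obtain ⟨k, t, ht, hk, hx⟩ := exists_subdivision x hε
  obtain ⟨η, hη, H⟩ := exists_orderIso_of_near ht hk hc
  obtain ⟨n, hn⟩ := exists_nat_one_div_lt hη
  have hn0 : (0 : ℝ) < (n : ℝ) + 1 := by positivity
  have hmem : ∀ s : I, (⌈((n : ℝ) + 1) * s⌉₊ : ℝ) / (n + 1) ∈ I := fun s => by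
    refine ⟨by positivity, ?_⟩
    rw [div_le_one hn0]
    have : ⌈((n : ℝ) + 1) * s⌉₊ ≤ n + 1 := Nat.ceil_le.2 (by
      push_cast
      exact mul_le_of_le_one_right hn0.le s.2.2)
    exact_mod_cast this
  -- `e` moves each `t i` to the next grid point at or above it, which is less than `η` away by the
  -- choice of `n`.
  obtain ⟨e, he, he'⟩ := H (fun i => ⟨_, hmem (t i)⟩) (by simp [ht.zero]) (by
      apply Subtype.ext
      have : ⌈(n : ℝ) + 1⌉₊ = n + 1 := by exact_mod_cast Nat.ceil_natCast (n + 1)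
      simp [hk, this, div_self hn0.ne']) (fun i _ => by
      have h1 := Nat.le_ceil (((n : ℝ) + 1) * t i)
      have h2 := Nat.ceil_lt_add_one (mul_nonneg hn0.le (t i).2.1)
      have h3 : (⌈((n : ℝ) + 1) * t i⌉₊ : ℝ) / (n + 1) - t i =
          (⌈((n : ℝ) + 1) * t i⌉₊ - ((n : ℝ) + 1) * t i) / (n + 1) := by
        field_simp
      rw [h3, abs_of_nonneg (div_nonneg (by linarith) hn0.le)]
      refine le_trans ?_ hn.le
      exact div_le_div_of_nonneg_right (by linarith) hn0.le)
  refine ⟨n, fun m => x (e.symm (Set.projIcc 0 1 zero_le_one ((m : ℝ) / (n + 1)))),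
    fun f hf => timeChangeDist_le e (le_sup_of_le_left he') (le_sup_of_le_right ?_)⟩
  refine iSup_le fun s => ?_
  set m : ℕ := ⌊((n : ℝ) + 1) * e s⌋₊ with hm
  have hm1 : (m : ℝ) ≤ ((n : ℝ) + 1) * e s := Nat.floor_le (mul_nonneg hn0.le (e s).2.1)
  -- The index `n + 1` occurs only at the endpoint `1`.
  have hmn : m ≤ n + 1 := by
    have : (m : ℝ) ≤ n + 1 := hm1.trans (mul_le_of_le_one_right hn0.le (e s).2.2)
    exact_mod_cast this
  have hmI : (m : ℝ) / (n + 1) ∈ I := ⟨by positivity, by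
    rw [div_le_one hn0]; exact_mod_cast hmn⟩
  have hfm := hf m hmn
  beta_reduce at hfm
  rw [Set.projIcc_of_mem zero_le_one hmI] at hfm
  refine (edist_triangle _ (x (e.symm ⟨(m : ℝ) / (n + 1), hmI⟩)) _).trans (add_le_add ?_ hfm)
  rcases eq_or_lt_of_le (unitInterval.le_one' (t := s)) with rfl | hs
  · have h1 : e 1 = 1 := e.map_top
    have h2 : (⟨(m : ℝ) / (n + 1), hmI⟩ : I) = e 1 := by
      apply Subtype.ext
      have : ⌊(n : ℝ) + 1⌋₊ = n + 1 := by exact_mod_cast Nat.floor_natCast (n + 1)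
      simp [hm, h1, this, div_self hn0.ne']
    rw [h2, e.symm_apply_apply, edist_self]
    exact zero_le
  · rw [← hk] at hs
    obtain ⟨i, hi, hsi⟩ := ht.exists_mem_Ico hs
    -- The grid point `m / (n + 1)` is at most `e s`, and at least `e (t i)` because that is itself
    -- a grid point below `e s`. Hence its preimage lies in the same cell as `s`.
    refine hx i hi s hsi _ ⟨?_, lt_of_le_of_lt ?_ hsi.2⟩
    · rw [OrderIso.le_symm_apply, he i hi.le]
      change (⌈((n : ℝ) + 1) * t i⌉₊ : ℝ) / (n + 1) ≤ (m : ℝ) / (n + 1)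
      refine div_le_div_of_nonneg_right ?_ hn0.le
      have h1 : (⌈((n : ℝ) + 1) * t i⌉₊ : ℝ) / (n + 1) ≤ e s := by
        have : e (t i) ≤ e s := e.monotone hsi.1
        rw [he i hi.le] at this
        exact this
      rw [div_le_iff₀' hn0] at h1
      exact Nat.cast_le.2 (Nat.le_floor h1)
    · rw [OrderIso.symm_apply_le]
      change (m : ℝ) / (n + 1) ≤ e s
      rw [div_le_iff₀' hn0]
      exact hm1

instance [TopologicalSpace.SeparableSpace S] : TopologicalSpace.SeparableSpace (Cadlag S) := by
  rcases isEmpty_or_nonempty (Cadlag S) with h | ⟨⟨x₀⟩⟩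
  · exact ⟨∅, Set.countable_empty, fun x => h.elim x⟩
  have : Nonempty S := ⟨x₀ 0⟩
  -- Finite lists keep the family countable; the default index `0` only fills in values beyond the
  -- list.
  let q : ℕ × List ℕ → Cadlag S := fun p =>
    step p.1 fun i => TopologicalSpace.denseSeq S (p.2.getD i 0)
  refine ⟨Set.range q, Set.countable_range q, fun x => EMetric.mem_closure_iff.2 fun ε hε => ?_⟩
  obtain ⟨c, hc0, hcε⟩ := ENNReal.lt_iff_exists_nnreal_btwn.1 hε
  have hc2 : (0 : ℝ≥0∞) < c / 2 := ENNReal.half_pos hc0.ne'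
  obtain ⟨n, v, H⟩ := exists_step_near x (c := c) (by exact_mod_cast hc0) hc2
  have hd : ∀ i, ∃ j, edist (v i) (TopologicalSpace.denseSeq S j) < c / 2 := fun i => by
    obtain ⟨_, ⟨j, rfl⟩, hj⟩ := EMetric.mem_closure_iff.1
      (TopologicalSpace.denseRange_denseSeq S (v i)) _ hc2
    exact ⟨j, hj⟩
  choose g hg using hd
  refine ⟨_, ⟨(n, (List.range (n + 2)).map g), rfl⟩, ?_⟩
  rw [edist_eq]
  refine (H _ fun i hi => ?_).trans_lt ?_
  · have : ((List.range (n + 2)).map g).getD i 0 = g i := by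
      rw [List.getD_eq_getElem _ _ (by simp; omega)]
      simp
    simp only [this]
    exact (hg i).le
  · rwa [ENNReal.add_halves, ENNReal.ofReal_coe_nnreal, sup_idem]

end Separable

/-! ### Completeness -/

section Complete

variable {S : Type*} [EMetricSpace S]

/-- An ε/3 argument gives right continuity and a Cauchy condition from the left; completeness of `S`
turns the latter into a left limit. -/
theorem exists_eq_of_uniform_limit [CompleteSpace S] (y : ℕ → Cadlag S) (x : I → S)
    (h : Tendsto (fun n => unifDist x (y n)) atTop (𝓝 0)) :
    ∃ z : Cadlag S, (z : I → S) = x := by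
  have hclose : ∀ ε : ℝ≥0∞, 0 < ε → ∃ n, unifDist x (y n) < ε := fun ε hε =>
    (h.eventually (gt_mem_nhds hε)).exists
  refine ⟨⟨x, fun t => ?_, fun t => ?_⟩, rfl⟩
  · rw [ENNReal.tendsto_nhds_zero]
    intro ε hε
    have hε3 : 0 < ε / 3 := ENNReal.div_pos hε.ne' (by simp)
    obtain ⟨n, hn⟩ := hclose _ hε3
    filter_upwards [((y n).right_continuous t).eventually (gt_mem_nhds hε3)] with s hs
    calc edist (x s) (x t) ≤ edist (x s) (y n s) + edist (y n s) (y n t) + edist (y n t) (x t) :=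
          edist_triangle4 _ _ _ _
      _ ≤ ε / 3 + ε / 3 + ε / 3 := add_le_add (add_le_add
          ((edist_le_unifDist x (y n) s).trans hn.le) hs.le)
          (by rw [edist_comm]; exact (edist_le_unifDist x (y n) t).trans hn.le)
      _ = ε := ENNReal.add_thirds _
  · rcases eq_or_lt_of_le (unitInterval.nonneg' (t := t)) with rfl | ht
    · refine ⟨x 0, ?_⟩
      rw [nhdsLT_zero]
      exact tendsto_bot
    have : (𝓝[<] t).NeBot := nhdsLT_neBot_of_exists_lt ⟨0, ht⟩
    have hcauchy : Cauchy (map x (𝓝[<] t)) := by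
      refine EMetric.cauchy_iff.2 ⟨NeBot.ne inferInstance, fun ε hε => ?_⟩
      obtain ⟨r, hr, hrε⟩ := exists_between hε
      have hr3 : 0 < r / 3 := ENNReal.div_pos hr.ne' (by simp)
      obtain ⟨n, hn⟩ := hclose _ hr3
      obtain ⟨a, ha, hosc⟩ := exists_Ioo_osc_le_left (y n) hr3 ht
      refine ⟨x '' Set.Ioo a t, image_mem_map (Ioo_mem_nhdsLT ha), ?_⟩
      rintro _ ⟨s, hs, rfl⟩ _ ⟨s', hs', rfl⟩
      refine lt_of_le_of_lt ?_ hrε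
      calc edist (x s) (x s')
          ≤ edist (x s) (y n s) + edist (y n s) (y n s') + edist (y n s') (x s') :=
            edist_triangle4 _ _ _ _
        _ ≤ r / 3 + r / 3 + r / 3 := add_le_add (add_le_add
            ((edist_le_unifDist x (y n) s).trans hn.le) (hosc s hs s' hs'))
            (by rw [edist_comm]; exact (edist_le_unifDist x (y n) s').trans hn.le)
        _ = r := ENNReal.add_thirds _
    obtain ⟨l, hl⟩ := CompleteSpace.complete hcauchy
    exact ⟨l, tendsto_iff_edist_tendsto_0.1 hl⟩

/-- The composition of a càdlàg function with a time change. -/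
def compOrderIso (x : Cadlag S) (e : I ≃o I) : Cadlag S where
  toFun := x ∘ e
  right_continuous t := by
    refine (x.right_continuous (e t)).comp (tendsto_nhdsWithin_of_tendsto_nhds_of_eventually_within
      _ (e.continuous.continuousAt.tendsto.mono_left nhdsWithin_le_nhds) ?_)
    filter_upwards [self_mem_nhdsWithin] with s hs using e.monotone hs
  left_limits t := by
    obtain ⟨l, hl⟩ := x.left_limits (e t)
    refine ⟨l, hl.comp (tendsto_nhdsWithin_of_tendsto_nhds_of_eventually_within
      _ (e.continuous.continuousAt.tendsto.mono_left nhdsWithin_le_nhds) ?_)⟩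
    filter_upwards [self_mem_nhdsWithin] with s hs using e.strictMono hs

/-- The composition `e (m - 1) ∘ ⋯ ∘ e 0`. -/
def iterComp (e : ℕ → I ≃o I) : ℕ → I ≃o I
  | 0 => OrderIso.refl I
  | m + 1 => (iterComp e m).trans (e m)

/-- The composition is `e (n + k - 1) ∘ ⋯ ∘ e n`, and the bound is the geometric sum of the lengths
of its factors. -/
theorem logDev_iterComp_le {e : ℕ → I ≃o I}
    (he : ∀ n, logDev (e n) ≤ ENNReal.ofReal ((1 / 2) ^ n)) (n k : ℕ) :
    logDev ((iterComp e n).symm.trans (iterComp e (n + k))) ≤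
      ENNReal.ofReal (2 * (1 / 2) ^ n - 2 * (1 / 2) ^ (n + k)) := by
  induction k with
  | zero =>
    have h : (iterComp e n).symm.trans (iterComp e (n + 0)) = OrderIso.refl I :=
      OrderIso.symm_trans_self _
    rw [h, logDev_refl]
    exact zero_le
  | succ k ih =>
    have heq : (iterComp e n).symm.trans (iterComp e (n + (k + 1))) =
        ((iterComp e n).symm.trans (iterComp e (n + k))).trans (e (n + k)) := rfl
    rw [heq]
    refine (logDev_trans _ _).trans ((add_le_add ih (he _)).trans (le_of_eq ?_))
    rw [← ENNReal.ofReal_add ?_ (by positivity)]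
    · congr 1
      ring
    · have : (1 / 2 : ℝ) ^ (n + k) ≤ (1 / 2) ^ n :=
        pow_le_pow_of_le_one (by norm_num) (by norm_num) (Nat.le_add_right n k)
      linarith

/-- If `∑ ‖e n‖⁰` converges, then so does the infinite composition `⋯ ∘ e 1 ∘ e 0`. -/
theorem exists_limit_iterComp {e : ℕ → I ≃o I}
    (he : ∀ n, logDev (e n) ≤ ENNReal.ofReal ((1 / 2) ^ n)) :
    ∃ f : I ≃o I, ∀ n, logDev ((iterComp e n).symm.trans f) ≤
      ENNReal.ofReal (2 * (1 / 2) ^ n) := by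
  have hlim : ∀ t : I, ∃ l : I, Tendsto (fun m => iterComp e m t) atTop (𝓝 l) := fun t => by
    refine cauchySeq_tendsto_of_complete
      (cauchySeq_of_le_geometric (1 / 2) 2 (by norm_num) fun n => ?_)
    have h1 := supDev_le_of_logDev_le (e n) (by positivity)
      (pow_le_one₀ (by norm_num) (by norm_num)) (he n)
    rw [dist_comm]
    exact abs_sub_le_of_supDev_le (by positivity) h1 (iterComp e n t)
  choose G hG using hlim
  -- Two-sided slope bounds are closed under pointwise limits and force `G` to be strictly
  -- increasing and continuous; uniform closeness to the identity alone would allow flat pieces and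
  -- jumps in the limit.
  have hbound : ∀ n, ∀ s t : I, s < t →
      Real.exp (-(2 * (1 / 2) ^ n)) * ((t : ℝ) - s) ≤
        (G ((iterComp e n).symm t) : ℝ) - G ((iterComp e n).symm s) ∧
      (G ((iterComp e n).symm t) : ℝ) - G ((iterComp e n).symm s) ≤
        Real.exp (2 * (1 / 2) ^ n) * ((t : ℝ) - s) := by
    intro n s t hst
    have hconv : Tendsto (fun m => (iterComp e m ((iterComp e n).symm t) : ℝ) -
        iterComp e m ((iterComp e n).symm s)) atTop
        (𝓝 ((G ((iterComp e n).symm t) : ℝ) - G ((iterComp e n).symm s))) :=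
      ((continuous_subtype_val.tendsto _).comp (hG _)).sub
        ((continuous_subtype_val.tendsto _).comp (hG _))
    have hev : ∀ᶠ m in atTop, Real.exp (-(2 * (1 / 2) ^ n)) * ((t : ℝ) - s) ≤
        (iterComp e m ((iterComp e n).symm t) : ℝ) - iterComp e m ((iterComp e n).symm s) ∧
        (iterComp e m ((iterComp e n).symm t) : ℝ) - iterComp e m ((iterComp e n).symm s) ≤
        Real.exp (2 * (1 / 2) ^ n) * ((t : ℝ) - s) := by
      filter_upwards [eventually_ge_atTop n] with m hm
      obtain ⟨k, rfl⟩ := Nat.exists_eq_add_of_le hm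
      refine (logDev_le_iff ((iterComp e n).symm.trans (iterComp e (n + k))).strictMono
        (by positivity)).1 ((logDev_iterComp_le he n k).trans (ENNReal.ofReal_le_ofReal ?_)) s t hst
      have : (0 : ℝ) ≤ 2 * (1 / 2) ^ (n + k) := by positivity
      linarith
    exact ⟨ge_of_tendsto hconv (hev.mono fun _ h => h.1),
      le_of_tendsto hconv (hev.mono fun _ h => h.2)⟩
  have hend : ∀ s : I, (∀ f : I ≃o I, f s = s) → G s = s := fun s hs =>
    tendsto_nhds_unique (hG s) (by simp only [hs]; exact tendsto_const_nhds)
  obtain ⟨f, hf⟩ := exists_orderIso_of_slope_bounds (Real.exp_pos _)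
    (hend 0 fun f => f.map_bot) (hend 1 fun f => f.map_top) (hbound 0)
  refine ⟨f, fun n => (logDev_le_iff
    ((iterComp e n).symm.trans f).strictMono (by positivity)).2 fun s t hst => ?_⟩
  have := hbound n s t hst
  rwa [← hf] at this

theorem two_inv_pow_eq (n : ℕ) : ENNReal.ofReal ((1 / 2) ^ n) = 1 / 2 ^ n := by
  rw [one_div, one_div, inv_pow, ENNReal.ofReal_inv_of_pos (by positivity),
    ENNReal.ofReal_pow (by norm_num)]
  simp

instance [CompleteSpace S] : CompleteSpace (Cadlag S) := by
  refine EMetric.complete_of_convergent_controlled_sequences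
    (fun n => ENNReal.ofReal ((1 / 2) ^ n)) (fun n => by simp) fun u hu => ?_
  have hex : ∀ n, ∃ e : I ≃o I, logDev e < ENNReal.ofReal ((1 / 2) ^ n) ∧
      unifDist (u n) (u (n + 1) ∘ e) < ENNReal.ofReal ((1 / 2) ^ n) := fun n => by
    have := hu n n (n + 1) le_rfl n.le_succ
    rw [edist_eq] at this
    exact timeChangeDist_lt_iff.1 this
  choose e he hue using hex
  obtain ⟨f, hf⟩ := exists_limit_iterComp fun n => (he n).le
  -- Since `e n ∘ g n = g (n + 1)`, successive functions `u n ∘ g n` are uniformly within `(1 / 2) ^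
  -- n`. The inverse of `g n` is the tail composition whose length `hf` bounds.
  let g : ℕ → I ≃o I := fun n => f.symm.trans (iterComp e n)
  have hstep : ∀ t n, edist (u n (g n t)) (u (n + 1) (g (n + 1) t)) ≤ 1 / 2 ^ n := fun t n => by
    rw [← two_inv_pow_eq]
    exact (edist_le_unifDist (u n) (u (n + 1) ∘ e n) (g n t)).trans (hue n).le
  have hlim : ∀ t, ∃ l, Tendsto (fun n => u n (g n t)) atTop (𝓝 l) := fun t =>
    cauchySeq_tendsto_of_complete
      (cauchySeq_of_edist_le_geometric_two 1 ENNReal.one_ne_top (hstep t))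
  choose x hx using hlim
  have hxd : ∀ n, unifDist x (compOrderIso (u n) (g n)) ≤ ENNReal.ofReal (2 * (1 / 2) ^ n) :=
    fun n => iSup_le fun t => by
      have := edist_le_of_edist_le_geometric_two_of_tendsto 1 (hstep t) (hx t) n
      rw [ENNReal.ofReal_mul zero_le_two, two_inv_pow_eq, edist_comm, ENNReal.ofReal_ofNat]
      rwa [mul_one, ← mul_one_div] at this
  have hzero : Tendsto (fun n : ℕ => ENNReal.ofReal (2 * (1 / 2) ^ n)) atTop (𝓝 0) := by
    have : Tendsto (fun n : ℕ => (2 : ℝ) * (1 / 2) ^ n) atTop (𝓝 (2 * 0)) :=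
      (tendsto_pow_atTop_nhds_zero_of_lt_one (by norm_num) (by norm_num)).const_mul 2
    simpa using ENNReal.tendsto_ofReal this
  obtain ⟨z, rfl⟩ := exists_eq_of_uniform_limit _ x
    (tendsto_of_tendsto_of_tendsto_of_le_of_le tendsto_const_nhds hzero (fun _ => zero_le) hxd)
  refine ⟨z, tendsto_iff_edist_tendsto_0.2 ?_⟩
  refine tendsto_of_tendsto_of_tendsto_of_le_of_le tendsto_const_nhds hzero
    (fun _ => zero_le) fun n => ?_
  simp only [edist_eq]
  refine timeChangeDist_le _ (hf n) (le_trans (le_of_eq ?_) (hxd n))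
  refine (unifDist_comm _ _).trans ((unifDist_comp_equiv _ _ (g n).toEquiv).symm.trans ?_)
  congr 1
  ext t
  simp [g]

end Complete

/-! ### Finite distances and the theorem for D([0,1]; D) -/

theorem edist_ne_top_of_values {S : Type*} [EMetricSpace S] (hS : ∀ a b : S, edist a b ≠ ⊤)
    (x y : Cadlag S) : edist x y ≠ ⊤ := by
  rw [edist_eq]
  exact timeChangeDist_ne_top isLength_logDev hS x y

theorem skorokhodDist_ne_top {S : Type*} [EMetricSpace S] (hS : ∀ a b : S, edist a b ≠ ⊤)
    (x y : Cadlag S) : skorokhodDist x y ≠ ⊤ := by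
  rw [skorokhodDist_eq]
  exact timeChangeDist_ne_top isLength_supDev hS x y

end Cadlag

/-- `d_D` and `d_D⁰` are (finite-valued) metrics on `D([0,1]; D)`, they induce the same topology,
`D([0,1]; D)` is separable under both of them, and it is complete under `d_D⁰`. -/
theorem mainTheorem3 :
    ∃ m m0 : MetricSpace SkorokhodDD,
      (∀ x y : SkorokhodDD, m.edist x y = Cadlag.skorokhodDist x y) ∧
      (∀ x y : SkorokhodDD, m0.edist x y = Cadlag.skorokhodDist0 x y) ∧
      m.toUniformSpace.toTopologicalSpace = m0.toUniformSpace.toTopologicalSpace ∧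
      @TopologicalSpace.SeparableSpace SkorokhodDD m.toUniformSpace.toTopologicalSpace ∧
      @TopologicalSpace.SeparableSpace SkorokhodDD m0.toUniformSpace.toTopologicalSpace ∧
      @CompleteSpace SkorokhodDD m0.toUniformSpace := by
  have hD : ∀ x y : SkorokhodD, edist x y ≠ ⊤ := Cadlag.edist_ne_top_of_values edist_ne_top
  have htop := Cadlag.skorokhodEMetric_topology_eq (S := SkorokhodD)
  -- Instance search applies the general result twice, starting from ℝ; completeness below is found
  -- in the same way.
  have hsep : @TopologicalSpace.SeparableSpace SkorokhodDD
    (inferInstance : EMetricSpace SkorokhodDD).toUniformSpace.toTopologicalSpace := inferInstance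
  refine ⟨@EMetricSpace.toMetricSpace _ (Cadlag.skorokhodEMetric SkorokhodD)
      (Cadlag.skorokhodDist_ne_top hD),
    EMetricSpace.toMetricSpace (Cadlag.edist_ne_top_of_values hD),
    fun _ _ => rfl, fun _ _ => rfl, htop, ?_, hsep, ?_⟩
  · exact htop ▸ hsep
  · exact (inferInstance : CompleteSpace SkorokhodDD)
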